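/- **Setting.** $Ty_n$ is the classical extensional higher-order logic $Q_0$ with primitive types $t$ (truth values) and $e_1,\dots,e_n$ (individuals), functional types $\alpha\beta$ (from $\alpha$ to $\beta$) and product types $\alpha\times\beta$, with pairs and projections, a description operator for each individual type, and arbitrary non-logical constants of any types. Terms may have free variables and are taken up to renaming of bound variables. Write $s=e_n$. Given a finite alphabet $\mathcal A=\{a_1,\dots,a_N\}$, the theory $Ty_n^{\mathcal A}$ has, among its constants, distinct constants $\mathbf C^0_s,\mathbf C^1_s,\dots,\mathbf C^N_s$ and $+_{sss}$, and the non-logical axioms $$\forall x_s\,(x_s+\mathbf C^0_s=x_s\ \wedge\ \mathbf C^0_s+x_s=x_s),\qquad \forall x_s\forall y_s\forall z_s\,((x_s+y_s)+z_s=x_s+(y_s+z_s)),$$ $$\forall x_s\forall y_s\forall z_s\,(x_s+\mathbf C^i_s+y_s\neq x_s+\mathbf C^j_s+z_s)\quad(1\le i<j\le N).$$ $Ty_n^{\mathcal A+}$ is an extension of $Ty_n^{\mathcal A}$ by additional non-logical constants. For a set $\Delta$ of formulas, $\Delta\vdash\varphi$ means provability from the hypotheses $\Delta$ (variables free in the hypotheses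 used may not be generalized). For a word $w\in\mathcal A^*$ the term $T_A(w)$ of type $s$ is given by $T_A(\varepsilon)=\mathbf C^0_s$, $T_A(a_i)=\mathbf C^i_s$, and $T_A(a_iw)=\mathbf C^i_s+T_A(w)$ for $w\ne\varepsilon$. An *$\alpha$-language* is a set of pairs $(w,A_\alpha)$ of a word $w\in\mathcal A^*$ and a $Ty_n^{\mathcal A}$ term $A_\alpha$ of type $\alpha$. It is *logically closed* if $(w,B_\alpha)\in\mathcal L$, $(w,C_\alpha)\in\mathcal L$ and $\vdash A_\alpha=B_\alpha\vee A_\alpha=C_\alpha$ in $Ty_n^{\mathcal A}$ imply $(w,A_\alpha)\in\mathcal L$. The *logical join* of two $\alpha$-languages $\mathcal L,\mathcal K$ is the least logically closed $\alpha$-language that includes $\mathcal L\cup\mathcal K$. Let $\Delta$ be a set of $Ty_n^{\mathcal A+}$ formulas and $L_{s\alpha t}$ a $Ty_n^{\mathcal A+}$ term. An $\alpha$-language $\mathcal L$ is *represented by* $(\Delta,L_{s\alpha t})$ if $\Delta$ is consistent and, for every word $w$ and every $Ty_n^{\mathcal A}$ term $A_\alpha$, $$(w,A_\alpha)\in\mathcal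 L\iff\Delta\vdash L_{s\alpha t}\,T_A(w)\,A_\alpha .$$ This representation is *pseudo-canonic* if moreover 1. for every word $w$ there are finitely many (possibly zero) $Ty_n^{\mathcal A}$ terms $A^1_\alpha,\dots,A^l_\alpha$ with $\Delta\vdash L_{s\alpha t}\,T_A(w)=\bigvee_{i=1}^{l}(=A^i_\alpha)$, and 2. $\Delta$ is conservative over $Ty_n^{\mathcal A}$: for every $Ty_n^{\mathcal A}$ formula $A_t$, $\ \vdash A_t$ in $Ty_n^{\mathcal A}$ if and only if $\Delta\vdash A_t$. Here $(=A_\alpha)$ is $\lambda x_\alpha(x_\alpha=A_\alpha)$ with $x_\alpha$ not free in $A_\alpha$; for terms of type $\alpha t$ the disjunction is pointwise, $P\vee Q=\lambda x_\alpha(P\,x_\alpha\vee Q\,x_\alpha)$, and the empty disjunction is $\lambda x_\alpha F$, where $F$ denotes falsehood. **Proposition 7.6.** Let $\alpha$-languages $\mathcal L$ and $\mathcal K$ have pseudo-canonic representations $(\Delta,L_{s\alpha t})$ and $(\Delta,K_{s\alpha t})$ respectively, with the same $\Delta$. Then their logical join is represented by $(\Delta,\,L_{s\alpha t}\vee K_{s\alpha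 t})$, where $L_{s\alpha t}\vee K_{s\alpha t}=\lambda x_s\lambda x_\alpha(L_{s\alpha t}\,x_s\,x_\alpha\vee K_{s\alpha t}\,x_s\,x_\alpha)$ with bound variables not free in $L_{s\alpha t}$, $K_{s\alpha t}$, and this representation is again pseudo-canonic. -/

import Mathlib

namespace TyN

universe u v

/-- Types over `n` sorts of individuals: the truth type `t`, the individual types `e i`,
functional types `fn α β` (functions from `α` to `β`) and product types. -/
inductive Ty (n : ℕ) : Type
  | t : Ty n
  | e (i : Fin n) : Ty n
  | fn (α β : Ty n) : Ty n
  | prod (α β : Ty n) : Ty n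
  deriving DecidableEq

infixr:60 " ⇒ " => Ty.fn

/-- Terms over a family `C` of non-logical constants, up to renaming of bound variables.
For every type `α` there are variables `var α 0, var α 1, …`, which may occur free.
De Bruijn indices are kept separately for every type: in `lam α M` the variable `var α 0` of `M` is
the bound one, `var α (i + 1)` of `M` is the variable `var α i` of the surrounding scope, and the
variables of the types other than `α` are those of the surrounding scope.
`iota i` is the description operator of the individual type `e i`. -/
inductive Term {n : ℕ} (C : Ty n → Type u) : Ty n → Type u
  | var (α : Ty n) (i : ℕ) : Term C α
  | con {α : Ty n} (c : C α) : Term C α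
  | iota (i : Fin n) : Term C ((Ty.e i ⇒ Ty.t) ⇒ Ty.e i)
  | app {α β : Ty n} (F : Term C (α ⇒ β)) (A : Term C α) : Term C β
  | lam (α : Ty n) {β : Ty n} (M : Term C β) : Term C (α ⇒ β)
  | eq {α : Ty n} (A B : Term C α) : Term C Ty.t
  | pair {α β : Ty n} (A : Term C α) (B : Term C β) : Term C (Ty.prod α β)
  | fst {α β : Ty n} (P : Term C (Ty.prod α β)) : Term C α
  | snd {α β : Ty n} (P : Term C (Ty.prod α β)) : Term C β

/-- Formulas are the terms of type `t`. -/
abbrev Formula {n : ℕ} (C : Ty n → Type u) : Type u := Term C Ty.t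

/-! ### Renaming and substitution of free variables -/

/-- A renaming of variables, type by type, carried under a binder of type `α`. -/
def upRen {n : ℕ} (α : Ty n) (ρ : Ty n → ℕ → ℕ) : Ty n → ℕ → ℕ := fun β i =>
  if β = α then
    match i with
    | 0 => 0
    | j + 1 => ρ β j + 1
  else ρ β i

namespace Term

variable {n : ℕ} {C : Ty n → Type u} {C' : Ty n → Type v}

def rename : {α : Ty n} → (Ty n → ℕ → ℕ) → Term C α → Term C α
  | _, ρ, var α i => var α (ρ α i)
  | _, _, con c => con c
  | _, _, iota i => iota i
  | _, ρ, app F A => app (rename ρ F) (rename ρ A)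
  | _, ρ, lam α M => lam α (rename (upRen α ρ) M)
  | _, ρ, eq A B => eq (rename ρ A) (rename ρ B)
  | _, ρ, pair A B => pair (rename ρ A) (rename ρ B)
  | _, ρ, fst P => fst (rename ρ P)
  | _, ρ, snd P => snd (rename ρ P)

/-- The term `A`, placed under one more binder of type `α` whose variable is not free in `A`. -/
def shift (α : Ty n) {β : Ty n} (A : Term C β) : Term C β :=
  rename (fun γ i => if γ = α then i + 1 else i) A

/-- A substitution carried under a binder of type `α`. -/
def upSubst (α : Ty n) (σ : (β : Ty n) → ℕ → Term C β) : (β : Ty n) → ℕ → Term C β := fun β i =>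
  if β = α then
    match i with
    | 0 => var β 0
    | j + 1 => shift α (σ β j)
  else shift α (σ β i)

/-- Simultaneous capture-avoiding substitution for the free variables. -/
def subst : {α : Ty n} → ((β : Ty n) → ℕ → Term C β) → Term C α → Term C α
  | _, σ, var α i => σ α i
  | _, _, con c => con c
  | _, _, iota i => iota i
  | _, σ, app F A => app (subst σ F) (subst σ A)
  | _, σ, lam α M => lam α (subst (upSubst α σ) M)
  | _, σ, eq A B => eq (subst σ A) (subst σ B)
  | _, σ, pair A B => pair (subst σ A) (subst σ B)
  | _, σ, fst P => fst (subst σ P)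
  | _, σ, snd P => snd (subst σ P)

/-- The substitution that replaces the variable of a removed binder of type `α` by `B`. -/
def single {α : Ty n} (B : Term C α) : (β : Ty n) → ℕ → Term C β := fun β i =>
  if h : β = α then
    match i with
    | 0 => h ▸ B
    | j + 1 => var β j
  else var β i

/-- The body `M` of an abstraction of type `α`, with the bound variable replaced by `B`. -/
def inst {α β : Ty n} (M : Term C β) (B : Term C α) : Term C β :=
  subst (single B) M

/-- Replacement of the constants along a map of the families of constants. -/
def mapCon (f : (α : Ty n) → C α → C' α) : {α : Ty n} → Term C α → Term C' α
  | _, var α i => var α i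
  | α, con c => con (f α c)
  | _, iota i => iota i
  | _, app F A => app (mapCon f F) (mapCon f A)
  | _, lam α M => lam α (mapCon f M)
  | _, eq A B => eq (mapCon f A) (mapCon f B)
  | _, pair A B => pair (mapCon f A) (mapCon f B)
  | _, fst P => fst (mapCon f P)
  | _, snd P => snd (mapCon f P)

/-! ### Connectives and quantifiers, defined from equality and abstraction -/

/-- `T` is `(=) = (=)`, where `(=)` is `λ x_t λ y_t (x_t = y_t)`. -/
def tru : Formula C :=
  eq (lam Ty.t (lam Ty.t (eq (var Ty.t 1) (var Ty.t 0))))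
    (lam Ty.t (lam Ty.t (eq (var Ty.t 1) (var Ty.t 0))))

/-- `F` is `(λ x_t T) = (λ x_t x_t)`. -/
def fls : Formula C := eq (lam Ty.t tru) (lam Ty.t (var Ty.t 0))

/-- `∀ x_α M`, the body `M` having `var α 0` as the quantified variable. -/
def all (α : Ty n) (M : Formula C) : Formula C := eq (lam α tru) (lam α M)

/-- `λ x_t λ y_t ((λ g g T T) = (λ g g x_t y_t))`, with `g` of type `t t t`. -/
def conjOp : Term C (Ty.t ⇒ Ty.t ⇒ Ty.t) :=
  lam Ty.t (lam Ty.t (eq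
    (lam (Ty.t ⇒ Ty.t ⇒ Ty.t) (app (app (var (Ty.t ⇒ Ty.t ⇒ Ty.t) 0) tru) tru))
    (lam (Ty.t ⇒ Ty.t ⇒ Ty.t)
      (app (app (var (Ty.t ⇒ Ty.t ⇒ Ty.t) 0) (var Ty.t 1)) (var Ty.t 0)))))

def conj (A B : Formula C) : Formula C := app (app conjOp A) B

/-- `A ⊃ B` is `A = (A ∧ B)`. -/
def imp (A B : Formula C) : Formula C := eq A (conj A B)

/-- `¬ A` is `F = A`. -/
def neg (A : Formula C) : Formula C := eq fls A

/-- `A ∨ B` is `¬ (¬ A ∧ ¬ B)`. -/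
def disj (A B : Formula C) : Formula C := neg (conj (neg A) (neg B))

/-- The shortcut `A ∨ B` for terms of type `α t`: the term `λ x_α (A x_α ∨ B x_α)`. -/
def disj₁ {α : Ty n} (A B : Term C (α ⇒ Ty.t)) : Term C (α ⇒ Ty.t) :=
  lam α (disj (app (shift α A) (var α 0)) (app (shift α B) (var α 0)))

/-- The same shortcut for terms of type `α β t`: the term `λ x_α (A x_α ∨ B x_α)`. -/
def disj₂ {α β : Ty n} (A B : Term C (α ⇒ β ⇒ Ty.t)) : Term C (α ⇒ β ⇒ Ty.t) :=
  lam α (disj₁ (app (shift α A) (var α 0)) (app (shift α B) (var α 0)))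

/-- The section `(= A)`, that is, `λ x_α (x_α = A)`. -/
def eqTo {α : Ty n} (A : Term C α) : Term C (α ⇒ Ty.t) :=
  lam α (eq (var α 0) (shift α A))

/-- The disjunction of finitely many terms of type `α t`; the empty one is `λ x_α F`. -/
def bigDisj {α : Ty n} : List (Term C (α ⇒ Ty.t)) → Term C (α ⇒ Ty.t)
  | [] => lam α fls
  | [P] => P
  | P :: Q :: l => disj₁ P (bigDisj (Q :: l))

end Term

/-! ### Provability -/

open Term in
/-- `Prov Ax Δ φ`: the formula `φ` is provable from the hypotheses `Δ` in the extension of the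
theory by the non-logical axioms `Ax` (closed formulas). This is Andrews' system `Q₀` over several
sorts of individuals, with pairs. The axioms are given as schemata. The rule of replacement of
equals by equals is split into the congruence rules and `eq_mp`; in `lam_congr` the abstracted
variable must not be free in the hypotheses, which the shift of the hypotheses expresses. -/
inductive Prov {n : ℕ} {C : Ty n → Type u} (Ax : Set (Formula C)) :
    Set (Formula C) → Formula C → Prop
  | nonlogical {Δ : Set (Formula C)} {φ : Formula C} : φ ∈ Ax → Prov Ax Δ φ
  | hyp {Δ : Set (Formula C)} {φ : Formula C} : φ ∈ Δ → Prov Ax Δ φ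
  | eq_mp {Δ : Set (Formula C)} {φ ψ : Formula C} :
      Prov Ax Δ (eq φ ψ) → Prov Ax Δ φ → Prov Ax Δ ψ
  | refl {Δ : Set (Formula C)} {α : Ty n} (A : Term C α) : Prov Ax Δ (eq A A)
  | app_congr {Δ : Set (Formula C)} {α β : Ty n} {F G : Term C (α ⇒ β)} {A B : Term C α} :
      Prov Ax Δ (eq F G) → Prov Ax Δ (eq A B) → Prov Ax Δ (eq (app F A) (app G B))
  | lam_congr {Δ : Set (Formula C)} {α β : Ty n} {M N : Term C β} :
      Prov Ax (shift α '' Δ) (eq M N) → Prov Ax Δ (eq (lam α M) (lam α N))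
  | eq_congr {Δ : Set (Formula C)} {α : Ty n} {A A' B B' : Term C α} :
      Prov Ax Δ (eq A A') → Prov Ax Δ (eq B B') → Prov Ax Δ (eq (eq A B) (eq A' B'))
  | pair_congr {Δ : Set (Formula C)} {α β : Ty n} {A A' : Term C α} {B B' : Term C β} :
      Prov Ax Δ (eq A A') → Prov Ax Δ (eq B B') → Prov Ax Δ (eq (pair A B) (pair A' B'))
  | fst_congr {Δ : Set (Formula C)} {α β : Ty n} {P P' : Term C (Ty.prod α β)} :
      Prov Ax Δ (eq P P') → Prov Ax Δ (eq (fst P) (fst P'))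
  | snd_congr {Δ : Set (Formula C)} {α β : Ty n} {P P' : Term C (Ty.prod α β)} :
      Prov Ax Δ (eq P P') → Prov Ax Δ (eq (snd P) (snd P'))
  /-- `(G T ∧ G F) = ∀ x_t (G x_t)` -/
  | bool {Δ : Set (Formula C)} (G : Term C (Ty.t ⇒ Ty.t)) :
      Prov Ax Δ (eq (conj (app G tru) (app G fls)) (all Ty.t (app (shift Ty.t G) (var Ty.t 0))))
  /-- `A = B ⊃ H A = H B` -/
  | leibniz {Δ : Set (Formula C)} {α : Ty n} (H : Term C (α ⇒ Ty.t)) (A B : Term C α) :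
      Prov Ax Δ (imp (eq A B) (eq (app H A) (app H B)))
  /-- `(F = G) = ∀ x_α (F x_α = G x_α)` -/
  | funext {Δ : Set (Formula C)} {α β : Ty n} (F G : Term C (α ⇒ β)) :
      Prov Ax Δ (eq (eq F G)
        (all α (eq (app (shift α F) (var α 0)) (app (shift α G) (var α 0)))))
  /-- `(λ x_α M) B = M(B)` -/
  | beta {Δ : Set (Formula C)} {α β : Ty n} (M : Term C β) (B : Term C α) :
      Prov Ax Δ (eq (app (lam α M) B) (inst M B))
  /-- `ι (λ x (A = x)) = A` for every individual type -/
  | descr {Δ : Set (Formula C)} {i : Fin n} (A : Term C (Ty.e i)) :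
      Prov Ax Δ (eq (app (iota i) (lam (Ty.e i) (eq (shift (Ty.e i) A) (var (Ty.e i) 0)))) A)
  | fst_pair {Δ : Set (Formula C)} {α β : Ty n} (A : Term C α) (B : Term C β) :
      Prov Ax Δ (eq (fst (pair A B)) A)
  | snd_pair {Δ : Set (Formula C)} {α β : Ty n} (A : Term C α) (B : Term C β) :
      Prov Ax Δ (eq (snd (pair A B)) B)
  | pair_eta {Δ : Set (Formula C)} {α β : Ty n} (P : Term C (Ty.prod α β)) :
      Prov Ax Δ (eq (pair (fst P) (snd P)) P)

/-! ### The symbolic type: the theories with an alphabet of `N` letters -/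

/-- The symbolic type: the last of the individual types. -/
def Ty.s {n : ℕ} : Ty (n + 1) := Ty.e (Fin.last n)

/-- The constants of the theory with an alphabet of `N` letters: a constant for the empty word, one
for each letter, the concatenation, and the arbitrary constants of the family `B`. -/
inductive SymCon {n : ℕ} (N : ℕ) (B : Ty (n + 1) → Type u) : Ty (n + 1) → Type u
  | empty : SymCon N B Ty.s
  | letter (i : Fin N) : SymCon N B Ty.s
  | cat : SymCon N B (Ty.s ⇒ Ty.s ⇒ Ty.s)
  | other {α : Ty (n + 1)} (c : B α) : SymCon N B α

section Symbolic

variable {n N : ℕ} {B : Ty (n + 1) → Type u}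

open Term

/-- The constant of the empty word. -/
def emptyT : Term (SymCon N B) Ty.s := con SymCon.empty

/-- The constant of the letter number `i`. -/
def letterT (i : Fin N) : Term (SymCon N B) Ty.s := con (SymCon.letter i)

/-- The concatenation `x + y`. -/
def catT (x y : Term (SymCon N B) Ty.s) : Term (SymCon N B) Ty.s :=
  app (app (con SymCon.cat) x) y

/-- The non-logical axioms of the symbolic type. -/
inductive SymAx : Formula (SymCon N B) → Prop
  /-- `∀ x (x + ε = x ∧ ε + x = x)` -/
  | unit : SymAx (all Ty.s (conj
      (eq (catT (var Ty.s 0) emptyT) (var Ty.s 0))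
      (eq (catT emptyT (var Ty.s 0)) (var Ty.s 0))))
  /-- `∀ x ∀ y ∀ z ((x + y) + z = x + (y + z))` -/
  | assoc : SymAx (all Ty.s (all Ty.s (all Ty.s (eq
      (catT (catT (var Ty.s 2) (var Ty.s 1)) (var Ty.s 0))
      (catT (var Ty.s 2) (catT (var Ty.s 1) (var Ty.s 0)))))))
  /-- `∀ x ∀ y ∀ z (x + aᵢ + y ≠ x + aⱼ + z)` for `i < j` -/
  | distinct (i j : Fin N) (hij : i < j) : SymAx (all Ty.s (all Ty.s (all Ty.s (neg (eq
      (catT (catT (var Ty.s 2) (letterT i)) (var Ty.s 1))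
      (catT (catT (var Ty.s 2) (letterT j)) (var Ty.s 0)))))))

/-- `Δ ⊢ φ` in the theory with the symbolic type and the further constants `B`. -/
def Provable (Δ : Set (Formula (SymCon N B))) (φ : Formula (SymCon N B)) : Prop :=
  Prov {ψ | SymAx ψ} Δ φ

def Consistent (Δ : Set (Formula (SymCon N B))) : Prop := ¬ Provable Δ fls

/-- The term that stands for a word: the concatenation of the constants of its letters. -/
def wordT : List (Fin N) → Term (SymCon N B) Ty.s
  | [] => emptyT
  | [a] => letterT a
  | a :: b :: w => catT (letterT a) (wordT (b :: w))

/-! ### Logically closed languages -/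

/-- An `α`-language: a set of pairs of a word and a term of type `α`. -/
abbrev Lang (N : ℕ) (B : Ty (n + 1) → Type u) (α : Ty (n + 1)) : Type u :=
  Set (List (Fin N) × Term (SymCon N B) α)

def LogicallyClosed {α : Ty (n + 1)} (L : Lang N B α) : Prop :=
  ∀ (w : List (Fin N)) (A A₁ A₂ : Term (SymCon N B) α), (w, A₁) ∈ L → (w, A₂) ∈ L →
    Provable ∅ (disj (eq A A₁) (eq A A₂)) → (w, A) ∈ L

/-- The least logically closed language that includes `L`. -/
def logicalClosure {α : Ty (n + 1)} (L : Lang N B α) : Lang N B α :=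
  ⋂₀ {M | L ⊆ M ∧ LogicallyClosed M}

/-- The logical join of two languages. -/
def logicalJoin {α : Ty (n + 1)} (L K : Lang N B α) : Lang N B α := logicalClosure (L ∪ K)

/-! ### Representations in an extension by new constants -/

variable {D : Ty (n + 1) → Type v}

/-- The inclusion of the constants of a theory into those of its extension by new constants `D`. -/
def extCon (D : Ty (n + 1) → Type v) (α : Ty (n + 1)) :
    SymCon N B α → SymCon N (fun β => B β ⊕ D β) α
  | .empty => .empty
  | .letter i => .letter i
  | .cat => .cat
  | .other c => .other (Sum.inl c)

/-- A term, read as a term of the extension by new constants `D`. -/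
def ext (D : Ty (n + 1) → Type v) {α : Ty (n + 1)} (A : Term (SymCon N B) α) :
    Term (SymCon N (fun β => B β ⊕ D β)) α :=
  mapCon (extCon D) A

/-- The language `L` is represented by `(Δ, T)`, where `Δ` and `T` belong to the extension of the
theory by the new constants `D`. -/
def Represents {α : Ty (n + 1)} (Δ : Set (Formula (SymCon N (fun β => B β ⊕ D β))))
    (T : Term (SymCon N (fun β => B β ⊕ D β)) (Ty.s ⇒ α ⇒ Ty.t)) (L : Lang N B α) : Prop :=
  Consistent Δ ∧ ∀ (w : List (Fin N)) (A : Term (SymCon N B) α),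
    (w, A) ∈ L ↔ Provable Δ (app (app T (wordT w)) (ext D A))

/-- The extension by the new constants `D` and the new axioms `Δ` is conservative. -/
def Conservative (Δ : Set (Formula (SymCon N (fun β => B β ⊕ D β)))) : Prop :=
  ∀ φ : Formula (SymCon N B), Provable ∅ φ ↔ Provable Δ (ext D φ)

/-- `(Δ, T)` is a pseudo-canonic representation of the language `L`. -/
def PseudoCanonic {α : Ty (n + 1)} (Δ : Set (Formula (SymCon N (fun β => B β ⊕ D β))))
    (T : Term (SymCon N (fun β => B β ⊕ D β)) (Ty.s ⇒ α ⇒ Ty.t)) (L : Lang N B α) : Prop :=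
  Represents Δ T L ∧
  (∀ w : List (Fin N), ∃ l : List (Term (SymCon N B) α),
    Provable Δ (eq (app T (wordT w)) (bigDisj (l.map fun A => eqTo (ext D A))))) ∧
  Conservative Δ

end Symbolic

end TyN

namespace TyN

universe u v

namespace Term

variable {n : ℕ} {C : Ty n → Type u} {C' : Ty n → Type v} {α β γ : Ty n}

/-! ### Substitution lemmas -/

/-! The pairs `(w, A)` with `Δ ⊢ (L ∨ K) w A` form a logically closed language containing both given
ones: by conservativity a base proof of `A = A₁ ∨ A = A₂` is available from `Δ`, and Leibniz' law
carries membership from `A₁` and `A₂` to `A`. Hence they include the join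
(`Represents.logicalJoin_subset`). Conversely, let `Δ ⊢ (L ∨ K) w A`. The finite disjunctions
describing `L w` and `K w` give `Δ ⊢ A = A₁ ∨ … ∨ A = Aₘ`, where every `Aᵢ` belongs to one of the
two languages. By conservativity this disjunction is provable in the base theory, and `m > 0`
because `Δ` is consistent. Logical closure admits only two alternatives at a time, so the term `A' =
if A = A₁ then A₂ else A` is used: provably `A'` is one of `A₂, …, Aₘ`, so it lies in the join by
induction, and provably `A = A₁ ∨ A = A'`, so `A` lies there too (`LogicallyClosed.mem_of_eqAny`).
The conditional is built by recursion on types (`condTerm`). Its properties, and the manipulation of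
disjunctions, need propositional reasoning inside the calculus, which `Prov.taut` derives from the
axioms of `Q₀`. -/

theorem upSubst_upRen (α : Ty n) (σ : (β : Ty n) → ℕ → Term C β) (ρ : Ty n → ℕ → ℕ) :
    (fun β i => upSubst α σ β (upRen α ρ β i)) = upSubst α fun β i => σ β (ρ β i) := by
  funext β i
  by_cases h : β = α
  · cases i <;> simp [upSubst, upRen, h]
  · simp [upSubst, upRen, h]

theorem upRen_upRen (α : Ty n) (ρ ρ' : Ty n → ℕ → ℕ) :
    (fun β i => upRen α ρ β (upRen α ρ' β i)) = upRen α fun β i => ρ β (ρ' β i) := by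
  funext β i
  by_cases h : β = α
  · cases i <;> simp [upRen, h]
  · simp [upRen, h]

theorem upSubst_var (α : Ty n) (ρ : Ty n → ℕ → ℕ) :
    upSubst α (fun β i => (var β (ρ β i) : Term C β)) = fun β i => var β (upRen α ρ β i) := by
  funext β i
  by_cases h : β = α
  · cases i <;> simp [upSubst, upRen, shift, rename, h]
  · simp [upSubst, upRen, shift, rename, h]

theorem subst_rename (σ : (β : Ty n) → ℕ → Term C β) (ρ : Ty n → ℕ → ℕ) (A : Term C α) :
    subst σ (rename ρ A) = subst (fun β i => σ β (ρ β i)) A := by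
  induction A generalizing σ ρ with
  | lam α M ih => simp only [rename, subst, ih, upSubst_upRen]
  | _ => simp_all [rename, subst]

theorem rename_rename (ρ ρ' : Ty n → ℕ → ℕ) (A : Term C α) :
    rename ρ (rename ρ' A) = rename (fun β i => ρ β (ρ' β i)) A := by
  induction A generalizing ρ ρ' with
  | lam α M ih => simp only [rename, ih, upRen_upRen]
  | _ => simp_all [rename]

theorem rename_eq_subst (ρ : Ty n → ℕ → ℕ) (A : Term C α) :
    rename ρ A = subst (fun β i => var β (ρ β i)) A := by
  induction A generalizing ρ with
  | lam α M ih => simp only [rename, subst, ih, upSubst_var]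
  | _ => simp_all [rename, subst]

theorem rename_id (A : Term C α) : rename (fun _ i => i) A = A := by
  have h (α : Ty n) : upRen α (fun _ i => i) = fun _ i => i := by
    funext β i
    cases i <;> simp [upRen]
  induction A with
  | lam α M ih => rw [rename, h, ih]
  | _ => simp_all [rename]

theorem subst_var (A : Term C α) : subst (fun β i => var β i) A = A := by
  rw [← rename_eq_subst (fun _ i => i), rename_id]

theorem rename_upRen_shift (ρ : Ty n → ℕ → ℕ) (A : Term C β) :
    rename (upRen α ρ) (shift α A) = shift α (rename ρ A) := by
  simp only [shift, rename_rename]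
  congr 1
  funext γ i
  by_cases h : γ = α <;> simp [upRen, h]

theorem rename_upSubst (α : Ty n) (ρ : Ty n → ℕ → ℕ) (σ : (β : Ty n) → ℕ → Term C β) :
    (fun β i => rename (upRen α ρ) (upSubst α σ β i)) =
      upSubst α fun β i => rename ρ (σ β i) := by
  funext β i
  by_cases h : β = α
  · subst h
    cases i
    · simp [upSubst, upRen, rename]
    · simp [upSubst, rename_upRen_shift]
  · simp [upSubst, h, rename_upRen_shift]

theorem rename_subst (ρ : Ty n → ℕ → ℕ) (σ : (β : Ty n) → ℕ → Term C β) (A : Term C α) :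
    rename ρ (subst σ A) = subst (fun β i => rename ρ (σ β i)) A := by
  induction A generalizing σ ρ with
  | lam α M ih => simp only [rename, subst, ih, rename_upSubst]
  | _ => simp_all [rename, subst]

@[simp] theorem subst_upSubst_shift (σ : (β : Ty n) → ℕ → Term C β) (A : Term C β) :
    subst (upSubst α σ) (shift α A) = shift α (subst σ A) := by
  simp only [shift, subst_rename, rename_subst]
  congr 1
  funext γ i
  by_cases h : γ = α <;> simp [upSubst, h, shift]

@[simp] theorem subst_single_shift (A : Term C β) (B : Term C α) :
    subst (single B) (shift α A) = A := by
  rw [shift, subst_rename]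
  refine Eq.trans ?_ (subst_var A)
  congr 1
  funext γ i
  by_cases h : γ = α <;> simp [single, h]

theorem shift_eq_subst (A : Term C β) :
    shift α A = subst (fun γ i => var γ (if γ = α then i + 1 else i)) A :=
  rename_eq_subst _ A

@[simp] theorem subst_single_var (B : Term C α) : subst (single B) (var α 0) = B := by
  simp [subst, single]

@[simp] theorem subst_upSubst_var (σ : (β : Ty n) → ℕ → Term C β) :
    subst (upSubst α σ) (var α 0) = var α 0 := by
  simp [subst, upSubst]

/-! ### Substitution through the defined connectives -/

section Connectives

variable (σ : (β : Ty n) → ℕ → Term C β)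

@[simp] theorem subst_app (F : Term C (α ⇒ β)) (A : Term C α) :
    subst σ (app F A) = app (subst σ F) (subst σ A) := rfl

@[simp] theorem subst_lam (M : Term C β) :
    subst σ (lam α M) = lam α (subst (upSubst α σ) M) := rfl

@[simp] theorem subst_eq (A B : Term C α) :
    subst σ (eq A B) = eq (subst σ A) (subst σ B) := rfl

@[simp] theorem subst_tru : subst σ tru = tru := by
  simp [tru, subst, upSubst, shift, rename]

@[simp] theorem subst_fls : subst σ fls = fls := by
  simp [fls]

@[simp] theorem subst_conjOp : subst σ conjOp = conjOp := by
  simp [conjOp, subst, upSubst, shift, rename]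

@[simp] theorem subst_conj (A B : Formula C) :
    subst σ (conj A B) = conj (subst σ A) (subst σ B) := by
  simp [conj]

@[simp] theorem subst_neg (A : Formula C) : subst σ (neg A) = neg (subst σ A) := by
  simp [neg]

@[simp] theorem subst_disj (A B : Formula C) :
    subst σ (disj A B) = disj (subst σ A) (subst σ B) := by
  simp [disj]

@[simp] theorem subst_imp (A B : Formula C) :
    subst σ (imp A B) = imp (subst σ A) (subst σ B) := by
  simp [imp]

@[simp] theorem subst_disj₁ (A B : Term C (α ⇒ Ty.t)) :
    subst σ (disj₁ A B) = disj₁ (subst σ A) (subst σ B) := by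
  simp [disj₁]

@[simp] theorem shift_tru : shift α (tru : Formula C) = tru := by simp [shift_eq_subst]

@[simp] theorem shift_fls : shift α (fls : Formula C) = fls := by simp [shift_eq_subst]

@[simp] theorem shift_disj₁ (A B : Term C (β ⇒ Ty.t)) :
    shift α (disj₁ A B) = disj₁ (shift α A) (shift α B) := by simp [shift_eq_subst]

end Connectives

/-- This is the contraction of a shifted abstraction applied to the fresh variable; it drives
`beta_shift` and, through it, `eta`. -/
theorem inst_rename_upRen_shift (M : Term C β) :
    inst (rename (upRen α fun γ i => if γ = α then i + 1 else i) M) (var α 0) = M := by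
  rw [inst, subst_rename]
  refine Eq.trans ?_ (subst_var M)
  congr 1
  funext γ i
  by_cases h : γ = α
  · subst h
    cases i <;> simp [upRen, single]
  · simp [upRen, single, h]

end Term

open Term

namespace Prov

variable {n : ℕ} {C : Ty n → Type u} {Ax : Set (Formula C)} {Δ : Set (Formula C)} {α β : Ty n}

/-! ### Equality and the truth values -/

theorem symm {A B : Term C α} (h : Prov Ax Δ (eq A B)) : Prov Ax Δ (eq B A) :=
  eq_mp (eq_congr h (refl A)) (refl A)

theorem trans {A B D : Term C α} (h : Prov Ax Δ (eq A B)) (h' : Prov Ax Δ (eq B D)) :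
    Prov Ax Δ (eq A D) :=
  eq_mp (eq_congr (refl A) h') h

theorem eq_mpr {φ ψ : Formula C} (h : Prov Ax Δ (eq φ ψ)) (h' : Prov Ax Δ ψ) : Prov Ax Δ φ :=
  eq_mp h.symm h'

theorem truth : Prov Ax Δ tru := refl _

theorem beta_of_eq {M : Term C β} {B : Term C α} {A : Term C β} (h : inst M B = A) :
    Prov Ax Δ (eq (app (lam α M) B) A) := h ▸ beta M B

theorem conj_congr {A A' B B' : Formula C} (h : Prov Ax Δ (eq A A')) (h' : Prov Ax Δ (eq B B')) :
    Prov Ax Δ (eq (conj A B) (conj A' B')) :=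
  app_congr (app_congr (refl _) h) h'

theorem tru_eq_inst {M : Formula C} (h : Prov Ax Δ (all α M)) (B : Term C α) :
    Prov Ax Δ (eq tru (inst M B)) :=
  (beta_of_eq (by simp [inst])).symm.trans ((app_congr h (refl B)).trans (beta M B))

theorem all_elim {M : Formula C} (h : Prov Ax Δ (all α M)) (B : Term C α) :
    Prov Ax Δ (inst M B) :=
  eq_mp (tru_eq_inst h B) truth

/-- Extensionality for the identity function turns its self-equality into `∀ x (x = x)`. As a
quantified formula is an equation between `λ x T` and an abstraction, its instances come in the form
`T = …`. -/
theorem tru_eq_refl (A : Term C α) : Prov Ax Δ (eq tru (eq A A)) := by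
  have h : Prov Ax Δ (all α (eq (var α 0) (var α 0))) := by
    refine eq_mp ((funext (lam α (var α 0)) (lam α (var α 0))).trans
      (eq_congr (refl _) (lam_congr ?_))) (refl _)
    have hb : Prov Ax (shift α '' Δ) (eq (app (shift α (lam α (var α 0))) (var α 0)) (var α 0)) :=
      beta_of_eq (by simp [inst, rename, upRen])
    exact eq_congr hb hb
  simpa [inst] using tru_eq_inst h A

theorem tru_eq_eq {A B : Term C α} (h : Prov Ax Δ (eq A B)) : Prov Ax Δ (eq tru (eq A B)) :=
  (tru_eq_refl A).trans (eq_congr (refl A) h)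

theorem conj_eq (A B : Formula C) : Prov Ax Δ (eq (conj A B)
    (eq (lam (Ty.t ⇒ Ty.t ⇒ Ty.t) (app (app (var (Ty.t ⇒ Ty.t ⇒ Ty.t) 0) tru) tru))
    (lam (Ty.t ⇒ Ty.t ⇒ Ty.t)
      (app (app (var (Ty.t ⇒ Ty.t ⇒ Ty.t) 0) (shift (Ty.t ⇒ Ty.t ⇒ Ty.t) A))
        (shift (Ty.t ⇒ Ty.t ⇒ Ty.t) B))))) := by
  refine (app_congr (beta _ A) (refl B)).trans (beta_of_eq ?_)
  -- The variables are written as shifts so that the lemmas on substitution into a shifted term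
  -- evaluate both contractions.
  have h : (var Ty.t 1 : Term C Ty.t) = shift Ty.t (var Ty.t 0) := by simp [shift, rename]
  have h' : (var Ty.t 0 : Term C Ty.t) = shift (Ty.t ⇒ Ty.t ⇒ Ty.t) (var Ty.t 0) := by
    simp [shift, rename]
  have h₂ : (var Ty.t 1 : Term C Ty.t) = shift (Ty.t ⇒ Ty.t ⇒ Ty.t) (var Ty.t 1) := by
    simp [shift, rename]
  simp only [inst, subst_eq, subst_lam, subst_app, subst_upSubst_var, subst_tru]
  rw [h₂, h', h]
  simp

theorem conj_tru_tru : Prov Ax Δ (eq (conj tru tru) tru) := by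
  refine (conj_eq _ _).trans ?_
  simpa using (tru_eq_refl _).symm

theorem conj_of_tru_eq {A B : Formula C} (h : Prov Ax Δ (eq tru A)) (h' : Prov Ax Δ (eq tru B)) :
    Prov Ax Δ (conj A B) :=
  eq_mp (conj_congr h h') (eq_mpr conj_tru_tru truth)

theorem beta_shift (M : Term C β) :
    Prov Ax Δ (eq (app (shift α (lam α M)) (var α 0)) M) :=
  beta_of_eq (inst_rename_upRen_shift M)

theorem bool_inst (M : Formula C) :
    Prov Ax Δ (eq (conj (inst M tru) (inst M fls)) (all Ty.t M)) :=
  (conj_congr (beta M tru) (beta M fls)).symm.trans ((bool (lam Ty.t M)).trans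
    (eq_congr (refl _) (lam_congr (beta_shift M))))

/-- For the identity predicate the axiom `bool` reads `(T ∧ F) = ∀ x x`, and `∀ x x` unfolds to the
definition of `F`. -/
theorem conj_tru_fls : Prov Ax Δ (eq (conj tru fls) fls) := by
  have h := bool_inst (Ax := Ax) (Δ := Δ) (var Ty.t 0)
  simp only [inst, subst_single_var] at h
  exact h

/-- An equation that holds for both truth values holds for every formula. -/
theorem eq_cases {M N : Term C α} (A : Formula C)
    (ht : Prov Ax Δ (eq (inst M tru) (inst N tru)))
    (hf : Prov Ax Δ (eq (inst M fls) (inst N fls))) :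
    Prov Ax Δ (eq (inst M A) (inst N A)) :=
  all_elim (M := eq M N)
    (eq_mp (bool_inst (eq M N)) (conj_of_tru_eq (tru_eq_eq ht) (tru_eq_eq hf))) A

theorem conj_tru (A : Formula C) : Prov Ax Δ (eq (conj tru A) A) := by
  simpa [inst] using eq_cases (M := conj tru (var Ty.t 0)) (N := var Ty.t 0) A
    (by simpa [inst] using conj_tru_tru) (by simpa [inst] using conj_tru_fls)

/-- Extensionality identifies `F`, which is `(λ x T) = (λ x x)`, with `∀ x (T = x)`; by `bool` the
latter is `(T = T) ∧ (T = F)`, which reduces to `T = F`. -/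
theorem tru_eq_fls : Prov Ax Δ (eq (eq tru fls) fls) := by
  have h : Prov Ax Δ (eq (conj (eq tru tru) (eq tru fls)) fls) := by
    refine Prov.trans (by simpa [inst] using bool_inst (eq tru (var Ty.t 0))) (symm ?_)
    refine (funext (lam Ty.t tru) (lam Ty.t (var Ty.t 0))).trans (eq_congr (refl _) (lam_congr ?_))
    exact eq_congr (beta_shift _) (beta_shift _)
  exact ((conj_congr (tru_eq_refl tru) (refl _)).symm.trans (conj_tru _)).symm.trans h

theorem tru_eq (A : Formula C) : Prov Ax Δ (eq (eq tru A) A) := by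
  simpa [inst] using eq_cases (M := eq tru (var Ty.t 0)) (N := var Ty.t 0) A
    (by simpa [inst] using (tru_eq_refl tru).symm) (by simpa [inst] using tru_eq_fls)

theorem eq_tru_of {A : Formula C} (h : Prov Ax Δ A) : Prov Ax Δ (eq tru A) :=
  eq_mpr (tru_eq A) h

theorem conj_intro {A B : Formula C} (h : Prov Ax Δ A) (h' : Prov Ax Δ B) : Prov Ax Δ (conj A B) :=
  conj_of_tru_eq (eq_tru_of h) (eq_tru_of h')

theorem all_intro {M : Formula C} (h : Prov Ax (shift α '' Δ) M) : Prov Ax Δ (all α M) :=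
  lam_congr (eq_tru_of h)

/-- A formula that holds for both truth values holds for every formula. -/
theorem cases {M : Formula C} (A : Formula C) (ht : Prov Ax Δ (inst M tru))
    (hf : Prov Ax Δ (inst M fls)) : Prov Ax Δ (inst M A) :=
  all_elim (eq_mp (bool_inst M) (conj_intro ht hf)) A

theorem mp {A B : Formula C} (h : Prov Ax Δ (imp A B)) (h' : Prov Ax Δ A) : Prov Ax Δ B :=
  eq_mp (conj_tru B) (eq_mpr (conj_congr (eq_tru_of h') (refl B)) (eq_mp h h'))

theorem ext {F G : Term C (α ⇒ β)}
    (h : Prov Ax (shift α '' Δ) (eq (app (shift α F) (var α 0)) (app (shift α G) (var α 0)))) :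
    Prov Ax Δ (eq F G) :=
  eq_mpr (funext F G) (all_intro h)

theorem eta (F : Term C (α ⇒ β)) : Prov Ax Δ (eq (lam α (app (shift α F) (var α 0))) F) :=
  ext (beta_shift _)

/-! ### The remaining truth-table entries -/

/-- The hypothesis is the implication `T = F ⊃ G` unfolded. Leibniz' law supplies it for `G` of the
form `H T = H F`: a constant `H` makes `G` true, the identity makes it false. -/
theorem leibniz_fls_tru (G : Formula C) (h : Prov Ax Δ (eq (eq tru fls) (conj (eq tru fls) G))) :
    Prov Ax Δ (eq (conj fls G) fls) :=
  (tru_eq_fls.symm.trans (h.trans (conj_congr tru_eq_fls (refl _)))).symm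

theorem fls_conj_tru : Prov Ax Δ (eq (conj fls tru) fls) := by
  refine (conj_congr (refl _) ?_).trans
    (leibniz_fls_tru _ (leibniz (lam Ty.t tru) tru fls))
  exact tru_eq_eq ((beta_of_eq (by simp [inst])).trans
    (beta_of_eq (A := tru) (by simp [inst])).symm)

theorem fls_conj_fls : Prov Ax Δ (eq (conj fls fls) fls) := by
  refine (conj_congr (refl _) ?_).trans
    (leibniz_fls_tru _ (leibniz (lam Ty.t (var Ty.t 0)) tru fls))
  exact (tru_eq_fls.symm.trans
    (eq_congr (beta_of_eq (by simp [inst])) (beta_of_eq (by simp [inst]))).symm)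

theorem conj_fls (A : Formula C) : Prov Ax Δ (eq (conj A fls) fls) := by
  simpa [inst] using eq_cases (M := conj (var Ty.t 0) fls) (N := fls) A
    (by simpa [inst] using conj_tru_fls) (by simpa [inst] using fls_conj_fls)

theorem fls_eq_tru : Prov Ax Δ (eq (eq fls tru) fls) := by
  have h : Prov Ax Δ (eq (eq fls tru) (conj (eq fls tru) _)) :=
    -- With `H = λ x (x = F)` the consequent `H F = H T` is `(F = F) = (T = F)`, which reduces to
    -- `F`.
    leibniz (lam Ty.t (eq (var Ty.t 0) fls)) fls tru
  refine h.trans ((conj_congr (refl _) ?_).trans (conj_fls _))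
  refine Prov.trans (eq_congr (A' := eq fls fls) (B' := eq tru fls)
    (beta_of_eq (by simp [inst])) (beta_of_eq (by simp [inst]))) ?_
  exact (eq_congr (tru_eq_refl fls).symm (refl _)).trans ((tru_eq _).trans tru_eq_fls)

end Prov

/-! ### Tautologies -/

/-- Propositional formulas with `k` atoms. -/
inductive PropForm (k : ℕ) : Type
  | atom (i : Fin k) : PropForm k
  | tru : PropForm k
  | fls : PropForm k
  | iff (P Q : PropForm k) : PropForm k
  | conj (P Q : PropForm k) : PropForm k

namespace PropForm

variable {k : ℕ}

def imp (P Q : PropForm k) : PropForm k := iff P (conj P Q)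

def neg (P : PropForm k) : PropForm k := iff fls P

def disj (P Q : PropForm k) : PropForm k := neg (conj (neg P) (neg Q))

def eval (b : Fin k → Bool) : PropForm k → Bool
  | atom i => b i
  | tru => true
  | fls => false
  | iff P Q => P.eval b == Q.eval b
  | conj P Q => P.eval b && Q.eval b

variable {n : ℕ} {C : Ty n → Type u} {Ax : Set (Formula C)} {Δ : Set (Formula C)}

/-- The formula that arises by putting the formulas `v i` for the atoms. -/
def interp (v : Fin k → Formula C) : PropForm k → Formula C
  | atom i => v i
  | tru => Term.tru
  | fls => Term.fls
  | iff P Q => Term.eq (P.interp v) (Q.interp v)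
  | conj P Q => Term.conj (P.interp v) (Q.interp v)

theorem subst_interp (σ : (β : Ty n) → ℕ → Term C β) (v : Fin k → Formula C) (P : PropForm k) :
    subst σ (P.interp v) = P.interp fun i => subst σ (v i) := by
  induction P with
  | _ => simp_all [interp]

/-- The formula for a truth value. -/
def ofBool : Bool → Formula C
  | true => Term.tru
  | false => Term.fls

theorem interp_ofBool (b : Fin k → Bool) (P : PropForm k) :
    Prov Ax Δ (eq (P.interp fun i => ofBool (b i)) (ofBool (P.eval b))) := by
  induction P with
  | iff P Q hP hQ =>
    refine (Prov.eq_congr hP hQ).trans ?_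
    rw [eval]
    cases P.eval b <;> cases Q.eval b
    · exact (Prov.tru_eq_refl _).symm
    · exact Prov.fls_eq_tru
    · exact Prov.tru_eq_fls
    · exact (Prov.tru_eq_refl _).symm
  | conj P Q hP hQ =>
    refine (Prov.conj_congr hP hQ).trans ?_
    rw [eval]
    cases P.eval b <;> cases Q.eval b
    · exact Prov.fls_conj_fls
    · exact Prov.fls_conj_tru
    · exact Prov.conj_tru_fls
    · exact Prov.conj_tru_tru
  | _ => exact Prov.refl _

/-- Induction on the set of atoms not yet replaced by truth values: each step abstracts one atom to
a variable and applies `Prov.cases`. Once none is left, the truth table decides. -/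
theorem prov_interp_of_finset (P : PropForm k) (hP : ∀ b, P.eval b = true) (s : Finset (Fin k))
    (v : Fin k → Formula C) (hv : ∀ i ∉ s, ∃ b, v i = ofBool b) : Prov Ax Δ (P.interp v) := by
  induction s using Finset.induction_on generalizing v with
  | empty =>
    choose b hb using fun i => hv i (Finset.notMem_empty i)
    obtain rfl : v = fun i => ofBool (b i) := funext hb
    refine Prov.eq_mpr (interp_ofBool b P) ?_
    rw [hP]
    exact Prov.truth
  | insert a s _ ih =>
    have h (A : Formula C) : inst (P.interp (Function.update (fun i => shift Ty.t (v i)) a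
        (var Ty.t 0))) A = P.interp (Function.update v a A) := by
      rw [inst, subst_interp]
      congr 1
      funext i
      by_cases hi : i = a
      · subst hi
        simp
      · simp [hi]
    have hu (b : Bool) : Prov Ax Δ (P.interp (Function.update v a (ofBool b))) := by
      refine ih _ fun i hi => ?_
      by_cases hia : i = a
      · exact ⟨b, by simp [hia]⟩
      · simpa [hia] using hv i (by simp [hia, hi])
    have := Prov.cases (Ax := Ax) (Δ := Δ) (v a) (by rw [h]; exact hu true)
      (by rw [h]; exact hu false)
    rwa [h, Function.update_eq_self] at this

end PropForm

theorem Prov.taut {n k : ℕ} {C : Ty n → Type u} {Ax Δ : Set (Formula C)} (P : PropForm k)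
    (v : Fin k → Formula C) (hP : ∀ b, P.eval b = true := by decide) : Prov Ax Δ (P.interp v) :=
  P.prov_interp_of_finset hP Finset.univ v fun i hi => absurd (Finset.mem_univ i) hi

/-! ### Conditional terms -/

namespace Term

variable {n : ℕ} {C : Ty n → Type u} {C' : Ty n → Type v} {β : Ty n}

/-- The term `if p then A else B`. -/
def condTerm : {α : Ty n} → Formula C → Term C α → Term C α → Term C α
  | Ty.t, p, A, B => disj (conj p A) (conj (neg p) B)
  | Ty.e i, p, A, B => app (iota i) (lam (Ty.e i)
      (disj (conj (shift (Ty.e i) p) (eq (shift (Ty.e i) A) (var (Ty.e i) 0)))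
        (conj (neg (shift (Ty.e i) p)) (eq (shift (Ty.e i) B) (var (Ty.e i) 0)))))
  | Ty.fn α _, p, A, B =>
      lam α (condTerm (shift α p) (app (shift α A) (var α 0)) (app (shift α B) (var α 0)))
  | Ty.prod _ _, p, A, B => pair (condTerm p (fst A) (fst B)) (condTerm p (snd A) (snd B))

@[simp] theorem subst_condTerm (σ : (β : Ty n) → ℕ → Term C β) {α : Ty n} (p : Formula C)
    (A B : Term C α) : subst σ (condTerm p A B) = condTerm (subst σ p) (subst σ A) (subst σ B) := by
  induction α generalizing σ p with
  | t => simp [condTerm]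
  | e i => simp [condTerm, subst.eq_3]
  | fn α β _ ih => simp [condTerm, ih]
  | prod α β ih ih' => simp [condTerm, subst.eq_7, subst.eq_8, subst.eq_9, ih, ih']

/-- The formula `A = B₁ ∨ … ∨ A = Bₘ`. -/
def eqAny {α : Ty n} (A : Term C α) : List (Term C α) → Formula C
  | [] => fls
  | B :: l => disj (eq A B) (eqAny A l)

theorem subst_eqAny (σ : (β : Ty n) → ℕ → Term C β) {α : Ty n} (A : Term C α)
    (l : List (Term C α)) : subst σ (eqAny A l) = eqAny (subst σ A) (l.map (subst σ)) := by
  induction l with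
  | nil => simp [eqAny]
  | cons B l ih => simp [eqAny, ih]

theorem mapCon_eqAny (f : (α : Ty n) → C α → C' α) {α : Ty n} (A : Term C α)
    (l : List (Term C α)) : mapCon f (eqAny A l) = eqAny (mapCon f A) (l.map (mapCon f)) := by
  induction l with
  | nil => rfl
  | cons B l ih =>
    rw [eqAny, List.map_cons, eqAny, ← ih]
    rfl

end Term

namespace Prov

variable {n : ℕ} {C : Ty n → Type u} {Ax : Set (Formula C)} {Δ : Set (Formula C)} {α β : Ty n}

theorem condTerm_tru (A B : Term C α) : Prov Ax Δ (eq (condTerm tru A B) A) := by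
  induction α generalizing Δ with
  | t =>
    exact taut (.iff (.disj (.conj .tru (.atom 0)) (.conj (.neg .tru) (.atom 1))) (.atom 0))
      ![A, B]
  | e i =>
    rw [condTerm, shift_tru]
    exact (app_congr (refl _) (lam_congr (taut (.iff (.disj (.conj .tru (.atom 0))
      (.conj (.neg .tru) (.atom 1))) (.atom 0)) ![_, _]))).trans (descr A)
  | fn α β _ ih =>
    rw [condTerm, shift_tru]
    exact (lam_congr (ih _ _)).trans (eta A)
  | prod α β ih ih' => exact (pair_congr (ih _ _) (ih' _ _)).trans (pair_eta A)

theorem condTerm_fls (A B : Term C α) : Prov Ax Δ (eq (condTerm fls A B) B) := by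
  induction α generalizing Δ with
  | t =>
    exact taut (.iff (.disj (.conj .fls (.atom 0)) (.conj (.neg .fls) (.atom 1))) (.atom 1))
      ![A, B]
  | e i =>
    rw [condTerm, shift_fls]
    exact (app_congr (refl _) (lam_congr (taut (.iff (.disj (.conj .fls (.atom 0))
      (.conj (.neg .fls) (.atom 1))) (.atom 1)) ![_, _]))).trans (descr B)
  | fn α β _ ih =>
    rw [condTerm, shift_fls]
    exact (lam_congr (ih _ _)).trans (eta B)
  | prod α β ih ih' => exact (pair_congr (ih _ _) (ih' _ _)).trans (pair_eta B)

/-! ### Disjunctions -/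

theorem disj_congr {A A' B B' : Formula C} (h : Prov Ax Δ (eq A A')) (h' : Prov Ax Δ (eq B B')) :
    Prov Ax Δ (eq (disj A B) (disj A' B')) :=
  eq_congr (refl _) (conj_congr (eq_congr (refl _) h) (eq_congr (refl _) h'))

theorem disj_inl {A : Formula C} (B : Formula C) (h : Prov Ax Δ A) : Prov Ax Δ (disj A B) :=
  mp (taut (.imp (.atom 0) (.disj (.atom 0) (.atom 1))) ![A, B]) h

theorem disj_inr (A : Formula C) {B : Formula C} (h : Prov Ax Δ B) : Prov Ax Δ (disj A B) :=
  mp (taut (.imp (.atom 1) (.disj (.atom 0) (.atom 1))) ![A, B]) h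

theorem app_disj₁ (P Q : Term C (α ⇒ Ty.t)) (A : Term C α) :
    Prov Ax Δ (eq (app (disj₁ P Q) A) (disj (app P A) (app Q A))) :=
  beta_of_eq (by simp [inst])

theorem app_disj₂ (P Q : Term C (α ⇒ β ⇒ Ty.t)) (A : Term C α) :
    Prov Ax Δ (eq (app (disj₂ P Q) A) (disj₁ (app P A) (app Q A))) :=
  beta_of_eq (by simp [inst])

theorem app_shift_disj₁ (P Q : Term C (α ⇒ Ty.t)) :
    Prov Ax Δ (eq (app (shift α (disj₁ P Q)) (var α 0))
      (disj (app (shift α P) (var α 0)) (app (shift α Q) (var α 0)))) := by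
  rw [shift_disj₁]
  exact app_disj₁ _ _ _

/-- `lam_congr` would ask for the equations under shifted hypotheses. Instead, each operand is made
the argument of an abstraction, so that `app_congr` and beta suffice. -/
theorem disj₁_congr {P P' Q Q' : Term C (α ⇒ Ty.t)} (h : Prov Ax Δ (eq P P'))
    (h' : Prov Ax Δ (eq Q Q')) : Prov Ax Δ (eq (disj₁ P Q) (disj₁ P' Q')) := by
  have h₁ (R : Term C (α ⇒ Ty.t)) : Prov Ax Δ (eq
      (app (lam (α ⇒ Ty.t) (disj₁ (var (α ⇒ Ty.t) 0) (shift (α ⇒ Ty.t) Q))) R) (disj₁ R Q)) :=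
    beta_of_eq (by simp [inst])
  have h₂ (R : Term C (α ⇒ Ty.t)) : Prov Ax Δ (eq
      (app (lam (α ⇒ Ty.t) (disj₁ (shift (α ⇒ Ty.t) P') (var (α ⇒ Ty.t) 0))) R) (disj₁ P' R)) :=
    beta_of_eq (by simp [inst])
  exact ((h₁ P).symm.trans ((app_congr (refl _) h).trans (h₁ P'))).trans
    ((h₂ Q).symm.trans ((app_congr (refl _) h').trans (h₂ Q')))

theorem disj₁_assoc (P Q R : Term C (α ⇒ Ty.t)) :
    Prov Ax Δ (eq (disj₁ (disj₁ P Q) R) (disj₁ P (disj₁ Q R))) := by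
  refine ext ?_
  refine ((app_shift_disj₁ _ _).trans (disj_congr (app_shift_disj₁ _ _) (refl _))).trans
    (Prov.trans ?_ ((app_shift_disj₁ _ _).trans (disj_congr (refl _) (app_shift_disj₁ _ _))).symm)
  exact taut (.iff (.disj (.disj (.atom 0) (.atom 1)) (.atom 2))
    (.disj (.atom 0) (.disj (.atom 1) (.atom 2)))) ![_, _, _]

theorem fls_disj₁ (P : Term C (α ⇒ Ty.t)) : Prov Ax Δ (eq (disj₁ (lam α fls) P) P) :=
  ext ((app_shift_disj₁ _ _).trans ((disj_congr (beta_shift _) (refl _)).trans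
    (taut (.iff (.disj .fls (.atom 0)) (.atom 0)) ![_])))

theorem disj₁_fls (P : Term C (α ⇒ Ty.t)) : Prov Ax Δ (eq (disj₁ P (lam α fls)) P) :=
  ext ((app_shift_disj₁ _ _).trans ((disj_congr (refl _) (beta_shift _)).trans
    (taut (.iff (.disj (.atom 0) .fls) (.atom 0)) ![_])))

theorem bigDisj_append : ∀ l l' : List (Term C (α ⇒ Ty.t)),
    Prov Ax Δ (eq (disj₁ (bigDisj l) (bigDisj l')) (bigDisj (l ++ l')))
  | [], _ => fls_disj₁ _
  | [_], [] => disj₁_fls _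
  | [_], _ :: _ => refl _
  | P :: Q :: l, l' => (disj₁_assoc _ _ _).trans
      (disj₁_congr (refl P) (bigDisj_append (Q :: l) l'))

theorem app_eqTo (A B : Term C α) : Prov Ax Δ (eq (app (eqTo B) A) (eq A B)) :=
  beta_of_eq (by simp [inst])

theorem app_bigDisj_eqTo (A : Term C α) : ∀ l : List (Term C α),
    Prov Ax Δ (eq (app (bigDisj (l.map eqTo)) A) (eqAny A l))
  | [] => beta_of_eq (by simp [inst, eqAny])
  -- `eqAny` always ends in `F`, whereas `bigDisj` of a single term does not.
  | [B] => (app_eqTo A B).trans (taut (.iff (.atom 0) (.disj (.atom 0) .fls)) ![eq A B])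
  | B :: B' :: l => (app_disj₁ _ _ _).trans
      (disj_congr (app_eqTo A B) (app_bigDisj_eqTo A (B' :: l)))

theorem eqAny_of_mem {A : Term C α} {l : List (Term C α)} (h : A ∈ l) : Prov Ax Δ (eqAny A l) := by
  induction l with
  | nil => simp at h
  | cons B l ih =>
    rcases List.mem_cons.1 h with rfl | h
    · exact disj_inl _ (refl _)
    · exact disj_inr _ (ih h)

theorem eqAny_congr {A A' : Term C α} (h : Prov Ax Δ (eq A A')) (l : List (Term C α)) :
    Prov Ax Δ (eq (eqAny A l) (eqAny A' l)) := by
  induction l with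
  | nil => exact refl _
  | cons B l ih => exact disj_congr (eq_congr h (refl _)) ih

/-! ### Removing one alternative from a disjunction of equations -/

/-- If the condition `A = A₁` fails, the conditional takes its second branch, which is `A` itself.
-/
theorem eq_or_eq_condTerm (A A₁ A₂ : Term C α) :
    Prov Ax Δ (disj (eq A A₁) (eq A (condTerm (eq A A₁) A₂ A))) := by
  have h := cases (Ax := Ax) (Δ := Δ) (M := disj (var Ty.t 0) (eq (shift Ty.t A)
    (condTerm (var Ty.t 0) (shift Ty.t A₂) (shift Ty.t A)))) (eq A A₁)
    (by simpa [inst] using disj_inl _ truth)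
    (by simpa [inst] using disj_inr _ (condTerm_fls _ _).symm)
  simpa [inst] using h

/-- If `A = A₁`, the conditional equals `A₂`; otherwise it equals `A`, whose first alternative is
then excluded. The case distinction is made on a variable standing for `A = A₁`, also in the
hypothesis. -/
theorem eqAny_condTerm {A A₁ A₂ : Term C α} {l : List (Term C α)}
    (h : Prov Ax Δ (eqAny A (A₁ :: A₂ :: l))) :
    Prov Ax Δ (eqAny (condTerm (eq A A₁) A₂ A) (A₂ :: l)) := by
  have hs (B : Formula C) : (A₂ :: l).map (subst (single B) ∘ shift Ty.t) = A₂ :: l := by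
    refine (List.map_congr_left fun D _ => ?_).trans (List.map_id _)
    exact subst_single_shift D B
  have hc := cases (Ax := Ax) (Δ := Δ) (M := imp
    (disj (var Ty.t 0) (eqAny (shift Ty.t A) ((A₂ :: l).map (shift Ty.t))))
    (eqAny (condTerm (var Ty.t 0) (shift Ty.t A₂) (shift Ty.t A)) ((A₂ :: l).map (shift Ty.t))))
    (eq A A₁)
  simp only [inst, subst_imp, subst_disj, subst_single_var, subst_eqAny, subst_single_shift,
    subst_condTerm, List.map_map, hs] at hc
  refine mp (hc ?_ ?_) h
  · have ht : Prov Ax Δ (eqAny (condTerm tru A₂ A) (A₂ :: l)) :=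
      eq_mpr (eqAny_congr (condTerm_tru _ _) _) (eqAny_of_mem List.mem_cons_self)
    exact mp (taut (.imp (.atom 1) (.imp (.atom 0) (.atom 1)))
      ![disj tru (eqAny A (A₂ :: l)), eqAny (condTerm tru A₂ A) (A₂ :: l)]) ht
  · exact mp (taut (.imp (.iff (.atom 0) (.atom 1)) (.imp (.disj .fls (.atom 1)) (.atom 0)))
      ![eqAny (condTerm fls A₂ A) (A₂ :: l), eqAny A (A₂ :: l)]) (eqAny_congr (condTerm_fls _ _) _)

theorem app_of_disj_eq {H : Term C (α ⇒ Ty.t)} {A A₁ A₂ : Term C α}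
    (h : Prov Ax Δ (disj (eq A A₁) (eq A A₂))) (h₁ : Prov Ax Δ (app H A₁))
    (h₂ : Prov Ax Δ (app H A₂)) : Prov Ax Δ (app H A) := by
  have ht := taut (Ax := Ax) (Δ := Δ) (.imp (.disj (.atom 0) (.atom 1))
    (.imp (.imp (.atom 0) (.iff (.atom 2) (.atom 3))) (.imp (.imp (.atom 1)
    (.iff (.atom 2) (.atom 4))) (.imp (.atom 3) (.imp (.atom 4) (.atom 2))))))
    ![eq A A₁, eq A A₂, app H A, app H A₁, app H A₂]
  exact mp (mp (mp (mp (mp ht h) (leibniz H A A₁)) (leibniz H A A₂)) h₁) h₂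

end Prov

/-! ### Languages -/

section Symbolic

variable {n N : ℕ} {B : Ty (n + 1) → Type u} {D : Ty (n + 1) → Type v} {α : Ty (n + 1)}

/-- The step from binary to finite closure, by induction on the list. The list must be nonempty,
since closure needs members to start from; a single alternative is used twice. -/
theorem LogicallyClosed.mem_of_eqAny {L : Lang N B α} (hL : LogicallyClosed L) {w : List (Fin N)} :
    ∀ {l : List (Term (SymCon N B) α)} {A : Term (SymCon N B) α}, l ≠ [] →
      (∀ A' ∈ l, (w, A') ∈ L) → Provable ∅ (eqAny A l) → (w, A) ∈ L
  | [], _, hl, _, _ => absurd rfl hl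
  | [A₁], A, _, hm, h => by
    have h₁ : (w, A₁) ∈ L := hm _ (by simp)
    exact hL w A A₁ A₁ h₁ h₁ (Prov.mp (Prov.taut (.imp (.disj (.atom 0) .fls)
      (.disj (.atom 0) (.atom 0))) ![eq A A₁]) h)
  | A₁ :: A₂ :: l, A, _, hm, h => by
    have h₂ : (w, condTerm (eq A A₁) A₂ A) ∈ L :=
      hL.mem_of_eqAny (l := A₂ :: l) (by simp) (fun A' hA' => hm A' (by simp_all))
        (Prov.eqAny_condTerm h)
    exact hL w A A₁ _ (hm _ (by simp)) h₂ (Prov.eq_or_eq_condTerm A A₁ A₂)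

/-! ### The two inclusions between the join and the represented language -/

variable {Δ : Set (Formula (SymCon N (fun β => B β ⊕ D β)))}
  {TL TK : Term (SymCon N (fun β => B β ⊕ D β)) (Ty.s ⇒ α ⇒ Ty.t)} {L K : Lang N B α}

theorem provable_disj₂_iff {W : Term (SymCon N (fun β => B β ⊕ D β)) Ty.s}
    {A : Term (SymCon N (fun β => B β ⊕ D β)) α} :
    Provable Δ (app (app (disj₂ TL TK) W) A) ↔
      Provable Δ (disj (app (app TL W) A) (app (app TK W) A)) := by
  have h : Provable Δ (eq (app (app (disj₂ TL TK) W) A)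
      (disj (app (app TL W) A) (app (app TK W) A))) :=
    (Prov.app_congr (Prov.app_disj₂ _ _ _) (Prov.refl A)).trans (Prov.app_disj₁ _ _ _)
  exact ⟨Prov.eq_mp h, Prov.eq_mpr h⟩

/-- Each listed term satisfies its own disjunct by reflexivity. -/
theorem Represents.mem_of_eq_bigDisj (hL : Represents Δ TL L) {w : List (Fin N)}
    {l : List (Term (SymCon N B) α)}
    (h : Provable Δ (eq (app TL (wordT w)) (bigDisj (l.map fun A => eqTo (ext D A)))))
    {A : Term (SymCon N B) α} (hA : A ∈ l) : (w, A) ∈ L := by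
  rw [hL.2]
  refine Prov.eq_mpr (Prov.app_congr h (Prov.refl _)) ?_
  have := Prov.app_bigDisj_eqTo (Ax := {ψ | SymAx ψ}) (Δ := Δ) (ext D A) (l.map (ext D))
  rw [List.map_map] at this
  exact Prov.eq_mpr this (Prov.eqAny_of_mem (List.mem_map_of_mem hA))

theorem eq_bigDisj_append {w : List (Fin N)} {l l' : List (Term (SymCon N B) α)}
    (h : Provable Δ (eq (app TL (wordT w)) (bigDisj (l.map fun A => eqTo (ext D A)))))
    (h' : Provable Δ (eq (app TK (wordT w)) (bigDisj (l'.map fun A => eqTo (ext D A))))) :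
    Provable Δ (eq (app (disj₂ TL TK) (wordT w))
      (bigDisj ((l ++ l').map fun A => eqTo (ext D A)))) := by
  rw [List.map_append]
  exact (Prov.app_disj₂ _ _ _).trans ((Prov.disj₁_congr h h').trans (Prov.bigDisj_append _ _))

theorem Represents.logicalJoin_subset (hL : Represents Δ TL L) (hK : Represents Δ TK K)
    (hΔ : Conservative Δ) {w : List (Fin N)} {A : Term (SymCon N B) α}
    (h : (w, A) ∈ logicalJoin L K) :
    Provable Δ (app (app (disj₂ TL TK) (wordT w)) (ext D A)) := by
  -- The join lies in every closed language including both given ones, in particular in this one.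
  refine h {p | Provable Δ (app (app (disj₂ TL TK) (wordT p.1)) (ext D p.2))} ⟨?_, ?_⟩
  · rintro ⟨w, A⟩ (hA | hA)
    · exact provable_disj₂_iff.2 (Prov.disj_inl _ ((hL.2 w A).1 hA))
    · exact provable_disj₂_iff.2 (Prov.disj_inr _ ((hK.2 w A).1 hA))
  · intro w A A₁ A₂ h₁ h₂ h
    exact Prov.app_of_disj_eq ((hΔ _).1 h) h₁ h₂

theorem PseudoCanonic.mem_logicalJoin (hL : PseudoCanonic Δ TL L) (hK : PseudoCanonic Δ TK K)
    {w : List (Fin N)} {A : Term (SymCon N B) α}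
    (h : Provable Δ (app (app (disj₂ TL TK) (wordT w)) (ext D A))) : (w, A) ∈ logicalJoin L K := by
  obtain ⟨l, hl⟩ := hL.2.1 w
  obtain ⟨l', hl'⟩ := hK.2.1 w
  have hany := Prov.app_bigDisj_eqTo (Ax := {ψ | SymAx ψ}) (Δ := Δ) (ext D A)
    ((l ++ l').map (ext D))
  rw [List.map_map] at hany
  have hA : Provable Δ (eqAny (ext D A) ((l ++ l').map (ext D))) :=
    Prov.eq_mp hany (Prov.eq_mp (Prov.app_congr (eq_bigDisj_append hl hl') (Prov.refl _)) h)
  rintro M ⟨hM, hMc⟩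
  refine hMc.mem_of_eqAny (l := l ++ l') ?_ ?_ ?_
  -- An empty list would make the disjunction `F`, contradicting the consistency of `Δ`.
  · intro h0
    rw [h0] at hA
    exact hL.1.1 hA
  · intro A' hA'
    rcases List.mem_append.1 hA' with hA' | hA'
    · exact hM (Or.inl (hL.1.mem_of_eq_bigDisj hl hA'))
    · exact hM (Or.inr (hK.1.mem_of_eq_bigDisj hl' hA'))
  -- The disjunction of equations is the image of a base formula, so conservativity removes `Δ`.
  · rw [hL.2.2, ext, mapCon_eqAny]
    exact hA

end Symbolic

end TyN

open TyN in
theorem proposition7p6 {n N : ℕ} {B : Ty (n + 1) → Type*} {D : Ty (n + 1) → Type*}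
    {α : Ty (n + 1)}
    (L K : Lang N B α)
    (Δ : Set (Formula (SymCon N (fun β => B β ⊕ D β))))
    (TL TK : Term (SymCon N (fun β => B β ⊕ D β)) (Ty.s ⇒ α ⇒ Ty.t))
    (hL : PseudoCanonic Δ TL L) (hK : PseudoCanonic Δ TK K) :
    Represents Δ (Term.disj₂ TL TK) (logicalJoin L K) ∧
      PseudoCanonic Δ (Term.disj₂ TL TK) (logicalJoin L K) := by
  have h : Represents Δ (Term.disj₂ TL TK) (logicalJoin L K) :=
    ⟨hL.1.1, fun _ _ => ⟨hL.1.logicalJoin_subset hK.1 hL.2.2, hL.mem_logicalJoin hK⟩⟩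
  refine ⟨h, h, fun w => ?_, hL.2.2⟩
  obtain ⟨l, hl⟩ := hL.2.1 w
  obtain ⟨l', hl'⟩ := hK.2.1 w
  exact ⟨l ++ l', eq_bigDisj_append hl hl'⟩
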